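/- Let $\mathbb{K}$ be a field of characteristic zero, and let $H_{CK}$ be the Connes–Kreimer Hopf algebra over $\mathbb{K}$: it has the rooted forests as a basis, its product is the disjoint union, and its coproduct is the algebra morphism $\Delta$ such that $\Delta(B(x))=1\otimes B(x)+(B\otimes \mathrm{Id})(\Delta(x))$ for all $x$, where $B$ is the linear map sending a forest to the tree obtained by joining all its roots to a new root. Let $S$ be the antipode of $H_{CK}$. Let $\bullet$ be the bilinear product such that $F\bullet G=\sum_{v} F\bullet_v G$ for all rooted forests $F,G$, where $v$ runs over the vertices of $F$ and $F\bullet_v G$ is obtained from the disjoint union $FG$ by adding an edge from $v$ to each root of $G$. Let $\delta_1$ be the tree with one vertex and $\delta_n=\delta_{n-1}\bullet\delta_1$ for $n\geq 2$. Let $n\geq k\geq 2$. There are unique coefficients $a_{i_1,\ldots,i_n}\in\mathbb{K}$, indexed by the $(i_1,\ldots,i_n)\in\mathbb{N}^n$ with $1i_1+2i_2+\cdots+ni_n=n$, such that $$S(\delta_n)=\sum_{\substack{(i_1,\ldots,i_n)\in\mathbb{N}^n\\ 1i_1+\cdots+ni_n=n}} a_{i_1,\ldots,i_n}\,\delta_1^{i_1}\cdots\delta_n^{i_n}.$$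 Put $$b_{i_1,\ldots,i_n}=\frac{(-1)^{i_1+\cdots+i_n}}{(n-1)!}\,a_{i_1,\ldots,i_n},\qquad H_{m}^{(i)}=\sum_{1\leq p_1<\cdots<p_i\leq m}\frac{1}{p_1\cdots p_i}\quad(i,m\geq 1).$$ Then $$b_{n-k,0,\ldots,0,1,0,\ldots,0}=n-1-\sum_{i=1}^{k-2}H_{n-1}^{(i)},$$ where the $1$ is in position $k$ in the sequence $(n-k,0,\ldots,0,1,0,\ldots,0)$ of length $n$ (the sum is empty if $k=2$). -/

import Mathlib

open scoped TensorProduct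

noncomputable section

namespace ConnesKreimer

/-! ### Rooted trees -/

/-- Planar rooted trees: a root with the list of the subtrees attached to it. -/
inductive PTree : Type
  | node : List PTree → PTree

/-- Elementary moves between planar trees: permute the subtrees of the root, or make an elementary
move inside one of the subtrees. -/
inductive PTree.Rel : PTree → PTree → Prop
  | perm {l₁ l₂ : List PTree} : l₁.Perm l₂ → PTree.Rel (.node l₁) (.node l₂)
  | cong {t t' : PTree} (l₁ l₂ : List PTree) : PTree.Rel t t' →
      PTree.Rel (.node (l₁ ++ t :: l₂)) (.node (l₁ ++ t' :: l₂))

/-- Rooted trees (non planar, up to isomorphism): planar rooted trees up to permutations of the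
subtrees at each vertex. -/
def RTree : Type := Quot PTree.Rel

/-- A rooted forest is a finite multiset of rooted trees. -/
abbrev RForest : Type := Multiset RTree

/-- Evaluation of a planar tree by a rule that depends only on the multiset of values of the
subtrees of the root. -/
def PTree.fold {α : Type*} (f : Multiset α → α) : PTree → α
  | .node l => f (l.map (PTree.fold f) : List α)

theorem PTree.fold_node {α : Type*} (f : Multiset α → α) (l : List PTree) :
    PTree.fold f (.node l) = f (l.map (PTree.fold f) : List α) := by
  rw [PTree.fold]

theorem PTree.fold_rel {α : Type*} (f : Multiset α → α) {t t' : PTree} (h : PTree.Rel t t') :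
    PTree.fold f t = PTree.fold f t' := by
  induction h with
  | perm h => rw [fold_node, fold_node, Multiset.coe_eq_coe.2 (h.map _)]
  | cong l₁ l₂ _ ih => rw [fold_node, fold_node]; simp [ih]

namespace RTree

/-- The rooted tree underlying a planar rooted tree. -/
def mk (t : PTree) : RTree := Quot.mk PTree.Rel t

/-- A planar representative of a rooted tree. -/
def rep (t : RTree) : PTree := Quot.out t

theorem mk_rep (t : RTree) : mk t.rep = t := Quot.out_eq t

/-- The tree obtained from a forest by joining all its roots to a new root. -/
def node : RForest → RTree :=
  Quot.lift (fun l : List RTree => mk (.node (l.map rep)))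
    (fun _ _ h => Quot.sound (.perm (List.Perm.map _ h)))

theorem mk_node_congr {t t' : PTree} (l₁ l₂ : List PTree) (h : mk t = mk t') :
    mk (.node (l₁ ++ t :: l₂)) = mk (.node (l₁ ++ t' :: l₂)) := by
  have h' := Quot.eqvGen_exact h
  clear h
  induction h' with
  | rel _ _ h => exact Quot.sound (.cong l₁ l₂ h)
  | refl => rfl
  | symm _ _ _ ih => exact ih.symm
  | trans _ _ _ _ _ ih₁ ih₂ => exact ih₁.trans ih₂

theorem node_mk (l : List PTree) : node (l.map mk : List RTree) = mk (.node l) := by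
  have key : ∀ l₁ l₂ : List PTree,
      mk (.node (l₁ ++ l₂.map (fun t => (mk t).rep))) = mk (.node (l₁ ++ l₂)) := by
    intro l₁ l₂
    induction l₂ generalizing l₁ with
    | nil => rfl
    | cons t l₂ ih =>
      rw [List.map_cons, mk_node_congr (t' := t) l₁ _ (mk_rep _)]
      simpa using ih (l₁ ++ [t])
  have := key [] l
  simp only [List.nil_append] at this
  rw [← this]
  show mk (.node ((l.map mk).map rep)) = _
  rw [List.map_map]
  rfl

theorem induction {P : RTree → Prop} (h : ∀ F : RForest, (∀ t ∈ F, P t) → P (node F))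
    (t : RTree) : P t := by
  have key : ∀ t : PTree, P (mk t) := by
    intro t
    induction t using PTree.rec (motive_2 := fun l => ∀ t ∈ l, P (mk t)) with
    | node l ih =>
      rw [← node_mk]
      apply h
      intro t ht
      obtain ⟨t', ht', rfl⟩ := List.mem_map.1 (Multiset.mem_coe.1 ht)
      exact ih t' ht'
    | nil => rename_i h; exact absurd h (List.not_mem_nil)
    | cons t l iht ihl =>
      rename_i ht'
      rcases List.mem_cons.1 ht' with rfl | ht'
      · exact iht
      · exact ihl _ ht'
  exact Quot.ind key t

/-- Evaluation of a rooted tree by a rule on multisets of values. -/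
def fold {α : Type*} (f : Multiset α → α) : RTree → α :=
  Quot.lift (PTree.fold f) (fun _ _ h => PTree.fold_rel f h)

theorem fold_node {α : Type*} (f : Multiset α → α) (F : RForest) :
    fold f (node F) = f (F.map (fold f)) := by
  obtain ⟨l, rfl⟩ : ∃ l : List PTree, ((l.map mk : List RTree) : RForest) = F := by
    induction F using Quot.ind with
    | mk l =>
      refine ⟨l.map rep, congrArg _ ?_⟩
      rw [List.map_map]
      exact (List.map_congr_left fun t _ => mk_rep t).trans (List.map_id' l)
  rw [node_mk, Multiset.map_coe, List.map_map]
  exact PTree.fold_node f l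

/-- Recursion on rooted trees: the value at `node F` is computed from the multiset of the pairs
`(t, value at t)`, where `t` runs over the trees of `F`. -/
def recOn {α : Type*} (f : Multiset (RTree × α) → α) (t : RTree) : α :=
  (fold (fun s => ((node (s.map Prod.fst), f s) : RTree × α)) t).2

theorem recOn_node {α : Type*} (f : Multiset (RTree × α) → α) (F : RForest) :
    recOn f (node F) = f (F.map fun t => (t, recOn f t)) := by
  have h1 : ∀ t, (fold (fun s => ((node (s.map Prod.fst), f s) : RTree × α)) t).1 = t := by
    intro t
    induction t using RTree.induction with
    | h F ih =>
      rw [fold_node]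
      simp only [Multiset.map_map, Function.comp_apply]
      rw [Multiset.map_congr rfl ih, Multiset.map_id']
  unfold recOn
  rw [fold_node]
  simp only
  congr 1
  refine Multiset.map_congr rfl fun t _ => ?_
  exact Prod.ext (h1 t) rfl

open Classical in
/-- The multiset of all trees `t •_v G`, where `v` runs over the vertices of `t` and `t •_v G` is
obtained by joining the vertex `v` of `t` to all the roots of the forest `G`: here `v` is either the
root of `t`, or a vertex of one of the subtrees attached to the root. -/
def graftings (G : RForest) : RTree → Multiset RTree :=
  recOn fun s =>
    node (s.map Prod.fst + G) ::ₘ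
      s.bind fun p => p.2.map fun t' => node (t' ::ₘ (s.map Prod.fst).erase p.1)

open Classical in
theorem graftings_node (G F : RForest) :
    graftings G (node F) =
      node (F + G) ::ₘ F.bind fun t => (graftings G t).map fun t' => node (t' ::ₘ F.erase t) := by
  rw [graftings, recOn_node]
  simp [Multiset.bind_map]

end RTree

/-! ### The algebra of rooted forests -/

variable (K : Type*) [Field K]

/-- The vector space with basis the rooted forests, with the disjoint union as product: it is the
polynomial algebra generated by the rooted trees. -/
def HCK : Type _ := MvPolynomial RTree K

instance : CommRing (HCK K) := inferInstanceAs (CommRing (MvPolynomial RTree K))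

instance : Algebra K (HCK K) := inferInstanceAs (Algebra K (MvPolynomial RTree K))

/-- A tree, as an element of the algebra. -/
def tree (t : RTree) : HCK K := (MvPolynomial.X t : MvPolynomial RTree K)

/-- A forest, as an element of the algebra: the product of its trees. -/
def forest (F : RForest) : HCK K := (F.map (tree K)).prod

open Classical in
/-- The basis of rooted forests. -/
def forestBasis : Module.Basis RForest K (HCK K) :=
  ((MvPolynomial.basisMonomials RTree K).reindex Multiset.toFinsupp.symm.toEquiv :
    Module.Basis RForest K (MvPolynomial RTree K))

theorem forestBasis_apply (F : RForest) : forestBasis K F = forest K F := by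
  classical
  have h : forestBasis K F =
      (MvPolynomial.monomial (Multiset.toFinsupp F) (1 : K) : MvPolynomial RTree K) := by
    unfold forestBasis
    erw [Module.Basis.reindex_apply]
    rw [MvPolynomial.coe_basisMonomials]
    rfl
  rw [h]
  clear h
  unfold forest
  induction F using Multiset.induction with
  | empty => simp; rfl
  | cons t F ih =>
    rw [Multiset.map_cons, Multiset.prod_cons, ← ih]
    rw [← Multiset.singleton_add, map_add, Multiset.toFinsupp_singleton]
    have := MvPolynomial.monomial_mul (R := K) (s := Finsupp.single t 1)
      (s' := Multiset.toFinsupp F) (a := 1) (b := 1)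
    rw [mul_one] at this
    exact this.symm

variable {K} in
/-- The algebra morphism with given values on the trees. -/
def liftTree {A : Type*} [CommRing A] [Algebra K A] (f : RTree → A) : HCK K →ₐ[K] A :=
  (MvPolynomial.aeval f : MvPolynomial RTree K →ₐ[K] A)

variable {K} in
theorem liftTree_tree {A : Type*} [CommRing A] [Algebra K A] (f : RTree → A) (t : RTree) :
    liftTree f (tree K t) = f t :=
  MvPolynomial.aeval_X f t

variable {K} in
theorem algHom_forest {A : Type*} [CommRing A] [Algebra K A] (f : HCK K →ₐ[K] A) (F : RForest) :
    f (forest K F) = (F.map fun t => f (tree K t)).prod := by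
  unfold forest
  rw [map_multiset_prod, Multiset.map_map]
  rfl

variable {K} in
theorem algHom_ext_tree {A : Type*} [CommRing A] [Algebra K A] {f g : HCK K →ₐ[K] A}
    (h : ∀ t, f (tree K t) = g (tree K t)) : f = g :=
  MvPolynomial.algHom_ext (A := A) (f := f) (g := g) h

/-! ### The pre-Lie product -/

variable {K} in
/-- The derivation with given values on the trees. -/
def derivTree (f : RTree → HCK K) : Derivation K (HCK K) (HCK K) :=
  MvPolynomial.mkDerivation (σ := RTree) (A := MvPolynomial RTree K) K f

variable {K} in
theorem derivTree_tree (f : RTree → HCK K) (t : RTree) : derivTree f (tree K t) = f t :=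
  MvPolynomial.mkDerivation_X (R := K) (A := MvPolynomial RTree K) f t

/-- For a forest `G`, the derivation which maps a tree `t` to the sum of the trees `t •_v G`, where
`v` runs over the vertices of `t`; by the Leibniz rule, it maps any forest `F` to the sum of the
forests `F •_v G`, where `v` runs over the vertices of `F`. -/
def graftDerivation (G : RForest) : Derivation K (HCK K) (HCK K) :=
  derivTree fun t => ((t.graftings G).map (tree K)).sum

theorem graftDerivation_tree (G : RForest) (t : RTree) :
    graftDerivation K G (tree K t) = ((t.graftings G).map (tree K)).sum :=
  derivTree_tree _ t

/-- The pre-Lie product `x • y`, bilinear, with `F • G` the sum of the forests `F •_v G` over the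
vertices `v` of `F`, for all forests `F` and `G`. -/
def preLie (x y : HCK K) : HCK K :=
  (forestBasis K).constr K (fun G => graftDerivation K G x) y

theorem preLie_forest (x : HCK K) (G : RForest) :
    preLie K x (forest K G) = graftDerivation K G x := by
  unfold preLie
  rw [← forestBasis_apply, Module.Basis.constr_basis]

/-! ### The Hopf algebra structure -/

/-- The grafting operator: `B F` is the tree obtained by joining all the roots of the forest `F` to
a new root. -/
def B : HCK K →ₗ[K] HCK K :=
  (forestBasis K).constr K fun F => tree K (RTree.node F)

theorem B_forest (F : RForest) : B K (forest K F) = tree K (RTree.node F) := by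
  rw [B, ← forestBasis_apply, Module.Basis.constr_basis]

/-- The coproduct: the algebra morphism such that `Δ (B x) = 1 ⊗ B x + (B ⊗ id) (Δ x)`. -/
def comulHom : HCK K →ₐ[K] HCK K ⊗[K] HCK K :=
  liftTree <| RTree.recOn fun s =>
    1 ⊗ₜ[K] tree K (RTree.node (s.map Prod.fst)) +
      (B K).rTensor (HCK K) (s.map Prod.snd).prod

theorem comulHom_B (x : HCK K) :
    comulHom K (B K x) = 1 ⊗ₜ[K] B K x + (B K).rTensor (HCK K) (comulHom K x) := by
  have : (comulHom K).toLinearMap ∘ₗ B K =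
      (TensorProduct.mk K (HCK K) (HCK K) 1) ∘ₗ B K +
        (B K).rTensor (HCK K) ∘ₗ (comulHom K).toLinearMap := by
    refine (forestBasis K).ext fun F => ?_
    simp only [forestBasis_apply, LinearMap.comp_apply, LinearMap.add_apply, B_forest,
      AlgHom.toLinearMap_apply, algHom_forest, TensorProduct.mk_apply]
    simp only [comulHom, liftTree_tree]
    rw [RTree.recOn_node]
    simp [Multiset.map_map]
  exact LinearMap.congr_fun this x

/-- The counit: it maps every non empty forest to `0`. -/
def counitHom : HCK K →ₐ[K] K := liftTree fun _ => 0

theorem counitHom_tree (t : RTree) : counitHom K (tree K t) = 0 := liftTree_tree _ t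

theorem counitHom_B (x : HCK K) : counitHom K (B K x) = 0 := by
  have : (counitHom K).toLinearMap ∘ₗ B K = 0 := by
    refine (forestBasis K).ext fun F => ?_
    simp [forestBasis_apply, B_forest, counitHom_tree]
  exact LinearMap.congr_fun this x

variable {K} in
/-- Two algebra morphisms are equal if they agree on `B x` as soon as they agree on `x`. -/
theorem algHom_ext_B {A : Type*} [CommRing A] [Algebra K A] {f g : HCK K →ₐ[K] A}
    (h : ∀ x, f x = g x → f (B K x) = g (B K x)) : f = g := by
  refine algHom_ext_tree fun t => ?_
  induction t using RTree.induction with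
  | h F ih =>
    rw [← B_forest]
    apply h
    rw [algHom_forest, algHom_forest, Multiset.map_congr rfl ih]

theorem counit_rTensor :
    (Algebra.TensorProduct.map (counitHom K) (.id K (HCK K))).comp (comulHom K) =
      (Algebra.TensorProduct.lid K (HCK K)).symm := by
  refine algHom_ext_B fun x hx => ?_
  simp only [AlgHom.comp_apply, comulHom_B, map_add] at hx ⊢
  have h : ∀ y : HCK K ⊗[K] HCK K,
      Algebra.TensorProduct.map (counitHom K) (.id K (HCK K)) ((B K).rTensor (HCK K) y) = 0 := by
    intro y
    induction y with
    | zero => simp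
    | tmul a b => simp [counitHom_B]
    | add a b ha hb => rw [map_add, map_add, ha, hb, add_zero]
  rw [h]
  simp

theorem counit_lTensor :
    (Algebra.TensorProduct.map (.id K (HCK K)) (counitHom K)).comp (comulHom K) =
      (Algebra.TensorProduct.rid K K (HCK K)).symm := by
  refine algHom_ext_B fun x hx => ?_
  simp only [AlgHom.comp_apply, comulHom_B, map_add] at hx ⊢
  have h : ∀ y : HCK K ⊗[K] HCK K,
      Algebra.TensorProduct.map (.id K (HCK K)) (counitHom K) ((B K).rTensor (HCK K) y) =
        (B K).rTensor K (Algebra.TensorProduct.map (.id K (HCK K)) (counitHom K) y) := by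
    intro y
    induction y with
    | zero => simp
    | tmul a b => simp
    | add a b ha hb => simp only [map_add, ha, hb]
  rw [h, hx]
  simp [counitHom_B]

theorem comul_coassoc :
    (Algebra.TensorProduct.assoc K K K (HCK K) (HCK K) (HCK K)).toAlgHom.comp
      ((Algebra.TensorProduct.map (comulHom K) (.id K (HCK K))).comp (comulHom K)) =
      (Algebra.TensorProduct.map (.id K (HCK K)) (comulHom K)).comp (comulHom K) := by
  refine algHom_ext_B fun x hx => ?_
  simp only [AlgHom.comp_apply, comulHom_B, map_add] at hx ⊢
  have h₁ : ∀ y : HCK K ⊗[K] HCK K,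
      (Algebra.TensorProduct.assoc K K K (HCK K) (HCK K) (HCK K)).toAlgHom
        (Algebra.TensorProduct.map (comulHom K) (.id K (HCK K)) ((B K).rTensor (HCK K) y)) =
      1 ⊗ₜ[K] (B K).rTensor (HCK K) y + (B K).rTensor (HCK K ⊗[K] HCK K)
        ((Algebra.TensorProduct.assoc K K K (HCK K) (HCK K) (HCK K)).toAlgHom
          (Algebra.TensorProduct.map (comulHom K) (.id K (HCK K)) y)) := by
    intro y
    induction y with
    | zero => simp
    | tmul a b =>
      simp only [LinearMap.rTensor_tmul, Algebra.TensorProduct.map_tmul, comulHom_B,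
        TensorProduct.add_tmul, map_add]
      congr 1
      generalize comulHom K a = z
      induction z with
      | zero => simp
      | tmul c d => simp
      | add c d hc hd => simp only [map_add, TensorProduct.add_tmul, hc, hd]
    | add a b ha hb =>
      simp only [map_add, ha, hb, TensorProduct.tmul_add]
      abel
  have h₂ : ∀ y : HCK K ⊗[K] HCK K,
      Algebra.TensorProduct.map (.id K (HCK K)) (comulHom K) ((B K).rTensor (HCK K) y) =
        (B K).rTensor (HCK K ⊗[K] HCK K)
          (Algebra.TensorProduct.map (.id K (HCK K)) (comulHom K) y) := by
    intro y
    induction y with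
    | zero => simp
    | tmul a b => simp
    | add a b ha hb => simp only [map_add, ha, hb]
  rw [h₁, h₂, hx]
  simp only [Algebra.TensorProduct.map_tmul, map_one, AlgHom.id_apply, comulHom_B,
    TensorProduct.tmul_add]
  rw [← add_assoc]
  simp [Algebra.TensorProduct.one_def]

instance : Bialgebra K (HCK K) :=
  Bialgebra.ofAlgHom (comulHom K) (counitHom K)
    (comul_coassoc K) (counit_rTensor K) (counit_lTensor K)

theorem comulAlgHom_eq : Bialgebra.comulAlgHom K (HCK K) = comulHom K := rfl

theorem counitAlgHom_eq : Bialgebra.counitAlgHom K (HCK K) = counitHom K := rfl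

/-- Auxiliary recursion for the antipode: at a tree `t`, the value is `(id ⊗ S) (Δ t)`. -/
def antipodeAux : RTree → HCK K ⊗[K] HCK K :=
  RTree.fold fun s =>
    (B K).rTensor (HCK K) s.prod -
      1 ⊗ₜ[K] LinearMap.mul' K (HCK K) ((B K).rTensor (HCK K) s.prod)

/-- The antipode `S`, as an algebra morphism. -/
def antipodeHom : HCK K →ₐ[K] HCK K :=
  liftTree <| RTree.recOn fun s =>
    -LinearMap.mul' K (HCK K)
      ((B K).rTensor (HCK K) (s.map fun p => antipodeAux K p.1).prod)

theorem map_antipodeHom_tree (t : RTree) :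
    Algebra.TensorProduct.map (.id K (HCK K)) (antipodeHom K) (comulHom K (tree K t)) =
      antipodeAux K t := by
  induction t using RTree.induction with
  | h F ih =>
    have h : ∀ y : HCK K ⊗[K] HCK K,
        Algebra.TensorProduct.map (.id K (HCK K)) (antipodeHom K) ((B K).rTensor (HCK K) y) =
          (B K).rTensor (HCK K)
            (Algebra.TensorProduct.map (.id K (HCK K)) (antipodeHom K) y) := by
      intro y
      induction y with
      | zero => simp
      | tmul a b => simp
      | add a b ha hb => simp only [map_add, ha, hb]
    rw [← B_forest, comulHom_B, map_add, h, ← AlgHom.comp_apply, algHom_forest]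
    simp only [AlgHom.comp_apply]
    rw [Multiset.map_congr rfl ih, B_forest, antipodeAux, RTree.fold_node, ← antipodeAux]
    rw [Algebra.TensorProduct.map_tmul, antipodeHom, liftTree_tree, RTree.recOn_node]
    simp only [Multiset.map_map, Function.comp_def, map_one, TensorProduct.tmul_neg]
    abel

theorem mul_map_antipodeHom :
    ((Algebra.TensorProduct.lmul' K (S := HCK K)).comp
      (Algebra.TensorProduct.map (.id K (HCK K)) (antipodeHom K))).comp (comulHom K) =
      (Algebra.ofId K (HCK K)).comp (counitHom K) := by
  refine algHom_ext_tree fun t => ?_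
  simp only [AlgHom.comp_apply, map_antipodeHom_tree, counitHom_tree, map_zero]
  induction t using RTree.induction with
  | h F _ =>
    rw [antipodeAux, RTree.fold_node]
    have h : ∀ y : HCK K ⊗[K] HCK K,
        Algebra.TensorProduct.lmul' K (S := HCK K) y = LinearMap.mul' K (HCK K) y := fun _ => rfl
    simp [h]

open WithConv in
theorem conv_id_antipodeHom :
    (toConv (AlgHom.id K (HCK K)) * toConv (antipodeHom K) : WithConv (HCK K →ₐ[K] HCK K)) = 1 := by
  rw [AlgHom.convMul_def, AlgHom.convOne_def]
  exact congrArg toConv (mul_map_antipodeHom K)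

open WithConv in
theorem conv_antipodeHom_id :
    (toConv (antipodeHom K) * toConv (AlgHom.id K (HCK K)) : WithConv (HCK K →ₐ[K] HCK K)) = 1 := by
  have h₁ := conv_id_antipodeHom K
  have h₂ : (toConv (antipodeHom K) * toConv ((antipodeHom K).comp (antipodeHom K)) :
      WithConv (HCK K →ₐ[K] HCK K)) = 1 := by
    have h := AlgHom.comp_convMul_distrib (antipodeHom K) (toConv (AlgHom.id K (HCK K)))
      (toConv (antipodeHom K))
    rw [h₁] at h
    have h' := congrArg toConv h
    simp only [toConv_ofConv, AlgHom.comp_id] at h'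
    rw [← h', AlgHom.convOne_def, ofConv_toConv]
    refine congrArg toConv (AlgHom.ext fun x => ?_)
    simp [Algebra.ofId_apply]
  have h₃ := left_inv_eq_right_inv h₁ h₂
  rw [← h₃] at h₂
  exact h₂

instance : HopfAlgebra K (HCK K) where
  antipode := (antipodeHom K).toLinearMap
  mul_antipode_rTensor_comul :=
    congrArg (fun f : WithConv (HCK K →ₐ[K] HCK K) => f.ofConv.toLinearMap)
      (conv_antipodeHom_id K)
  mul_antipode_lTensor_comul :=
    congrArg (fun f : WithConv (HCK K →ₐ[K] HCK K) => f.ofConv.toLinearMap)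
      (conv_id_antipodeHom K)

/-! ### The Connes-Moscovici generators and the coefficients of their antipodes -/

/-- The tree with one vertex. -/
def vertex : RTree := RTree.node 0

/-- The generators `δ n` for `n ≥ 1`: `δ 1` is the tree with one vertex, and
`δ (n + 1) = δ n • δ 1`. The value at `0`, which is never used, is `0`. -/
def δ : ℕ → HCK K
  | 0 => 0
  | 1 => tree K vertex
  | n + 2 => preLie K (δ (n + 1)) (tree K vertex)

/-- The sequences `(i_1, …, i_n)` of natural numbers such that `1 i_1 + … + n i_n = n`. The entry
`i_(j+1)` is `i j`, for `j : Fin n`. -/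
def indices (n : ℕ) : Finset (Fin n → ℕ) :=
  (Fintype.piFinset fun _ => Finset.range (n + 1)).filter fun i =>
    ∑ j : Fin n, ((j : ℕ) + 1) * i j = n

theorem mem_indices {n : ℕ} (i : Fin n → ℕ) :
    i ∈ indices n ↔ ∑ j : Fin n, ((j : ℕ) + 1) * i j = n := by
  simp only [indices, Finset.mem_filter, Fintype.mem_piFinset, Finset.mem_range,
    and_iff_right_iff_imp]
  intro h j
  have h₁ : ((j : ℕ) + 1) * i j ≤ ∑ j : Fin n, ((j : ℕ) + 1) * i j :=
    Finset.single_le_sum (f := fun j : Fin n => ((j : ℕ) + 1) * i j)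
      (fun _ _ => Nat.zero_le _) (Finset.mem_univ j)
  nlinarith [Nat.zero_le ((j : ℕ) * i j)]

/-- The sequence `(n - k, 0, …, 0, 1, 0, …, 0)`, of length `n`, with the `1` in position `k`. -/
def hookIndex (n k : ℕ) (hk : 2 ≤ k) (hkn : k ≤ n) : indices n :=
  ⟨fun j => if (j : ℕ) + 1 = 1 then n - k else if (j : ℕ) + 1 = k then 1 else 0, by
    rw [mem_indices]
    obtain ⟨m, rfl⟩ : ∃ m, n = m + 1 := ⟨n - 1, by omega⟩
    rw [Fin.sum_univ_succ, Finset.sum_eq_single (⟨k - 2, by omega⟩ : Fin m)]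
    · rw [if_pos (by simp), if_neg (by simp), if_pos (by simp; omega)]
      simp only [Fin.val_zero, Fin.val_succ]
      omega
    · intro j _ hj
      have : (j : ℕ) ≠ k - 2 := fun h => hj (Fin.ext h)
      simp only [Fin.val_succ]
      rw [if_neg (by omega), if_neg (by omega), mul_zero]
    · simp⟩

/-- The family `a` consists of the coefficients of `S (δ n)` in the generators: `S (δ n)` is the sum
of the `a_(i_1, …, i_n) (δ 1)^(i_1) ⋯ (δ n)^(i_n)` over all `(i_1, …, i_n)` in `ℕ^n` with
`1 i_1 + … + n i_n = n`. -/
def IsAntipodeCoeff (n : ℕ) (a : indices n → K) : Prop :=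
  HopfAlgebra.antipode K (δ K n) = ∑ i : indices n, a i • ∏ j : Fin n, δ K ((j : ℕ) + 1) ^ i.1 j

variable {K} in
/-- The normalized coefficients
`b_(i_1, …, i_n) = (-1)^(i_1 + … + i_n) / (n - 1)! * a_(i_1, …, i_n)`, for `n ≥ 1`. -/
def normalizedCoeff {n : ℕ} (a : indices n → K) (i : indices n) : K :=
  (-1) ^ (∑ j, i.1 j) / ((n - 1).factorial : K) * a i

/-- The iterated harmonic sum: the sum of the `1 / (p_1 ⋯ p_i)` over all
`1 ≤ p_1 < … < p_i ≤ n`, that is over all subsets `{p_1, …, p_i}` of `{1, …, n}` with `i`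
elements. -/
def iteratedHarmonic (i n : ℕ) : K :=
  ∑ s ∈ (Finset.Icc 1 n).powersetCard i, 1 / ∏ p ∈ s, (p : K)

end ConnesKreimer

end

noncomputable section

namespace ConnesKreimer

/-! ### Vertices and graftings -/

namespace RTree

/-! Let N be the natural growth x ↦ x • δ_1, a derivation with δ_(m+2) = N δ_(m+1), and let D be the
derivation counting vertices. Cutting a tree that has just grown a leaf gives Δ ∘ N = (N ⊗ id + id ⊗
N + D ⊗ δ_1·) ∘ Δ (`comulHom_growth`). Convolution with the antipode turns this into S ∘ N = N ∘ S -
δ_1 · (D ∘ S) (`antipode_growth`).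

Since S(δ_(m+1)) has degree m + 1, it follows that S(δ_(m+1)) is a polynomial P_m in the generators,
with P_0 = -X_0 and P_(m+1) = shift P_m - (m + 1) X_0 P_m, where X_j stands for δ_(j+1) and the
derivation shift sends X_j to X_(j+1). The generators are algebraically independent
(`evalδ_injective`) and P_m is homogeneous of weight m + 1, so the coefficients a exist, are unique,
and are those of P_m.

By homogeneity, the coefficient of X_0^(n-k) X_(k-1) in P_(n-1) is ∂P_(n-1)/∂X_(k-1) at X_0 = 1, X_j
= 0 for j ≥ 1. Evaluation at this point kills shift, and the commutator of ∂_(j+1) with shift is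
∂_j, so these numbers satisfy a two-term recursion. Divided by the sign and by m!, it reads
u_(j+1)(m+1) = u_(j+1)(m) + u_j(m)/(m+1), the recursion obeyed by the H_m^(i) when the subsets of
{1, …, m+1} are sorted by whether they contain m + 1. -/

/-- The number of vertices of a rooted tree. -/
def size : RTree → ℕ := fold fun s => s.sum + 1

theorem size_node (F : RForest) : size (node F) = (F.map size).sum + 1 :=
  fold_node _ F

theorem size_vertex : size vertex = 1 := by
  simp [vertex, size_node]

/-- Bookkeeping for a grafting inside one subtree of the root; the additive form avoids truncated
subtraction. -/
theorem sum_size_cons_erase [DecidableEq RTree] {F : RForest} {t t' : RTree} (ht : t ∈ F) :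
    ((t' ::ₘ F.erase t).map size).sum + size t = (F.map size).sum + size t' := by
  conv_rhs => rw [← Multiset.cons_erase ht]
  simp only [Multiset.map_cons, Multiset.sum_cons]
  omega

theorem size_of_mem_graftings (G : RForest) (t : RTree) :
    ∀ t' ∈ graftings G t, size t' = size t + (G.map size).sum := by
  classical
  induction t using RTree.induction with
  | h F ih =>
    intro u hu
    rw [graftings_node, Multiset.mem_cons, Multiset.mem_bind] at hu
    rcases hu with rfl | ⟨t, ht, hu⟩
    · simp only [size_node, Multiset.map_add, Multiset.sum_add]
      omega
    · obtain ⟨t', ht', rfl⟩ := Multiset.mem_map.1 hu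
      have h₁ := ih t ht t' ht'
      have h₂ := sum_size_cons_erase (t' := t') ht
      rw [size_node, size_node]
      omega

theorem card_graftings (G : RForest) (t : RTree) : (graftings G t).card = size t := by
  classical
  induction t using RTree.induction with
  | h F ih =>
    rw [graftings_node, Multiset.card_cons, Multiset.card_bind, size_node]
    congr 2
    refine Multiset.map_congr rfl fun t ht => ?_
    simp [ih t ht]

end RTree

variable {K : Type*} [Field K]

/-! ### Forests as products, and extension of identities from trees to forests -/

theorem forest_zero : forest K 0 = 1 := by simp [forest]

theorem forest_cons (t : RTree) (F : RForest) :
    forest K (t ::ₘ F) = tree K t * forest K F := by simp [forest]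

theorem forest_add (F G : RForest) : forest K (F + G) = forest K F * forest K G := by
  simp [forest]

theorem forest_singleton (t : RTree) : forest K {t} = tree K t := by simp [forest]

theorem linearMap_ext_forest {M : Type*} [AddCommGroup M] [Module K M] {f g : HCK K →ₗ[K] M}
    (h : ∀ F, f (forest K F) = g (forest K F)) : f = g :=
  (forestBasis K).ext fun F => by rw [forestBasis_apply, h]

/-- Two derivations over an algebra morphism that agree on the trees of a forest agree on this
forest. -/
theorem eq_on_forest_of_leibniz {A : Type*} [CommRing A] [Algebra K A] (f : HCK K →ₐ[K] A)
    {d₁ d₂ : HCK K →ₗ[K] A} (h₁ : ∀ x y, d₁ (x * y) = d₁ x * f y + f x * d₁ y)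
    (h₂ : ∀ x y, d₂ (x * y) = d₂ x * f y + f x * d₂ y) (F : RForest)
    (h : ∀ t ∈ F, d₁ (tree K t) = d₂ (tree K t)) : d₁ (forest K F) = d₂ (forest K F) := by
  induction F using Multiset.induction with
  | empty =>
    -- The Leibniz rule at 1 * 1 forces both maps to vanish at 1.
    have e₁ := h₁ 1 1
    have e₂ := h₂ 1 1
    simp only [mul_one, one_mul, map_one, left_eq_add] at e₁ e₂
    rw [forest_zero, e₁, e₂]
  | cons t F ih =>
    rw [forest_cons, h₁, h₂, h t (Multiset.mem_cons_self t F),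
      ih fun u hu => h u (Multiset.mem_cons_of_mem hu)]

theorem eq_of_leibniz {A : Type*} [CommRing A] [Algebra K A] (f : HCK K →ₐ[K] A)
    {d₁ d₂ : HCK K →ₗ[K] A} (h₁ : ∀ x y, d₁ (x * y) = d₁ x * f y + f x * d₁ y)
    (h₂ : ∀ x y, d₂ (x * y) = d₂ x * f y + f x * d₂ y)
    (h : ∀ t, d₁ (tree K t) = d₂ (tree K t)) : d₁ = d₂ :=
  linearMap_ext_forest fun F => eq_on_forest_of_leibniz f h₁ h₂ F fun t _ => h t

/-- Equality of two derivations over an algebra morphism, by induction on trees. -/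
theorem eq_of_leibniz_of_B {A : Type*} [CommRing A] [Algebra K A] (f : HCK K →ₐ[K] A)
    {d₁ d₂ : HCK K →ₗ[K] A} (h₁ : ∀ x y, d₁ (x * y) = d₁ x * f y + f x * d₁ y)
    (h₂ : ∀ x y, d₂ (x * y) = d₂ x * f y + f x * d₂ y)
    (h : ∀ x, d₁ x = d₂ x → d₁ (B K x) = d₂ (B K x)) : d₁ = d₂ := by
  refine eq_of_leibniz f h₁ h₂ fun t => ?_
  induction t using RTree.induction with
  | h F ih =>
    rw [← B_forest]
    exact h _ (eq_on_forest_of_leibniz f h₁ h₂ F ih)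

open Classical in
theorem derivation_forest (d : Derivation K (HCK K) (HCK K)) (F : RForest) :
    d (forest K F) = (F.map fun t => d (tree K t) * forest K (F.erase t)).sum := by
  induction F using Multiset.induction with
  | empty => simp [forest_zero]
  | cons t F ih =>
    rw [forest_cons, d.leibniz, ih, Multiset.map_cons, Multiset.sum_cons, Multiset.erase_cons_head,
      smul_eq_mul, smul_eq_mul, ← Multiset.sum_map_mul_left, add_comm, mul_comm (forest K F)]
    congr 2
    refine Multiset.map_congr rfl fun u hu => ?_
    rw [Multiset.erase_cons_tail_of_mem hu, forest_cons]
    ring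

/-! ### The natural growth and the degree derivation -/

variable (K) in
/-- The natural growth: the derivation `x ↦ x • δ 1`. -/
abbrev growth : Derivation K (HCK K) (HCK K) := graftDerivation K {vertex}

variable (K) in
/-- The derivation that multiplies a forest by the number of its vertices. -/
def degreeDerivation : Derivation K (HCK K) (HCK K) :=
  derivTree fun t => (t.size : K) • tree K t

theorem degreeDerivation_tree (t : RTree) :
    degreeDerivation K (tree K t) = (t.size : K) • tree K t :=
  derivTree_tree _ t

theorem degreeDerivation_forest (F : RForest) :
    degreeDerivation K (forest K F) = (((F.map RTree.size).sum : ℕ) : K) • forest K F := by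
  induction F using Multiset.induction with
  | empty => simp [forest_zero]
  | cons t F ih =>
    rw [forest_cons, Derivation.leibniz, ih, degreeDerivation_tree, Multiset.map_cons,
      Multiset.sum_cons, Nat.cast_add, add_smul, smul_eq_mul, smul_eq_mul, mul_smul_comm,
      mul_smul_comm, mul_comm (forest K F), add_comm]

theorem degreeDerivation_B (x : HCK K) :
    degreeDerivation K (B K x) = B K x + B K (degreeDerivation K x) := by
  have : (degreeDerivation K).toLinearMap ∘ₗ B K =
      B K + B K ∘ₗ (degreeDerivation K).toLinearMap := by
    refine linearMap_ext_forest fun F => ?_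
    simp only [LinearMap.comp_apply, LinearMap.add_apply, Derivation.coeFn_coe, B_forest,
      degreeDerivation_tree, degreeDerivation_forest, map_smul, RTree.size_node]
    push_cast
    rw [add_smul, one_smul, add_comm]
  exact LinearMap.congr_fun this x

/-- The new leaf is attached either to a vertex of x or to the root created by `B`; in the latter
case it is one more tree of the forest under the root. -/
theorem growth_B (x : HCK K) :
    growth K (B K x) = B K (growth K x) + B K (x * tree K vertex) := by
  classical
  have : (growth K).toLinearMap ∘ₗ B K =
      B K ∘ₗ (growth K).toLinearMap + B K ∘ₗ LinearMap.mulRight K (tree K vertex) := by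
    refine linearMap_ext_forest fun F => ?_
    simp only [LinearMap.comp_apply, LinearMap.add_apply, Derivation.coeFn_coe, B_forest,
      LinearMap.mulRight_apply]
    rw [← forest_singleton vertex, ← forest_add, B_forest, graftDerivation_tree,
      RTree.graftings_node,
      Multiset.map_cons, Multiset.sum_cons, add_comm, derivation_forest, map_multiset_sum,
      Multiset.map_map, Multiset.map_bind, Multiset.sum_bind]
    congr 2
    refine Multiset.map_congr rfl fun t _ => ?_
    rw [Function.comp_apply, graftDerivation_tree, ← Multiset.sum_map_mul_right, map_multiset_sum]
    simp only [Multiset.map_map, Function.comp_def, ← forest_cons, B_forest]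
  exact LinearMap.congr_fun this x

/-- Growth adds exactly one vertex. The commutator of the two derivations is again a derivation, so
trees suffice. -/
theorem degreeDerivation_growth (x : HCK K) :
    degreeDerivation K (growth K x) = growth K (degreeDerivation K x) + growth K x := by
  have h : ⁅degreeDerivation K, growth K⁆.toLinearMap = (growth K).toLinearMap := by
    refine eq_of_leibniz (AlgHom.id K _) (fun x y => ?_) (fun x y => ?_) fun t => ?_
    · simp only [Derivation.coeFn_coe, Derivation.leibniz, smul_eq_mul, AlgHom.id_apply]
      ring
    · simp only [Derivation.coeFn_coe, Derivation.leibniz, smul_eq_mul, AlgHom.id_apply]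
      ring
    · have h : ∀ u ∈ RTree.graftings {vertex} t,
          degreeDerivation K (tree K u) = (t.size : K) • tree K u + tree K u := by
        intro u hu
        rw [degreeDerivation_tree, RTree.size_of_mem_graftings _ _ _ hu]
        simp [RTree.size_vertex, add_smul]
      rw [Derivation.coeFn_coe, Derivation.coeFn_coe, Derivation.commutator_apply,
        degreeDerivation_tree, Derivation.map_smul, graftDerivation_tree, map_multiset_sum,
        Multiset.map_map, Multiset.map_congr (f := degreeDerivation K ∘ tree K) rfl h,
        Multiset.sum_map_add, Multiset.smul_sum,
        Multiset.map_map]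
      exact add_sub_cancel_left _ _
  have h' := LinearMap.congr_fun h x
  rw [Derivation.coeFn_coe, Derivation.coeFn_coe, Derivation.commutator_apply] at h'
  exact sub_eq_iff_eq_add'.1 h'

/-! ### The natural growth, the coproduct and the antipode -/

variable (K) in
/-- The operator on the tensor square through which the coproduct transports the natural growth. -/
def growthTensor : HCK K ⊗[K] HCK K →ₗ[K] HCK K ⊗[K] HCK K :=
  (growth K).toLinearMap.rTensor (HCK K) + (growth K).toLinearMap.lTensor (HCK K) +
    TensorProduct.map (degreeDerivation K).toLinearMap (LinearMap.mulLeft K (tree K vertex))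

theorem growthTensor_tmul (x y : HCK K) :
    growthTensor K (x ⊗ₜ y) = growth K x ⊗ₜ y + x ⊗ₜ growth K y +
      degreeDerivation K x ⊗ₜ (tree K vertex * y) := rfl

theorem growthTensor_mul (x y : HCK K ⊗[K] HCK K) :
    growthTensor K (x * y) = growthTensor K x * y + x * growthTensor K y := by
  induction x with
  | zero => simp
  | add a b ha hb => simp only [add_mul, map_add, ha, hb]; abel
  | tmul a b =>
    induction y with
    | zero => simp
    | add c d hc hd => simp only [mul_add, map_add, hc, hd]; abel
    | tmul c d =>
      simp only [Algebra.TensorProduct.tmul_mul_tmul, growthTensor_tmul, Derivation.leibniz,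
        smul_eq_mul, add_mul, mul_add, TensorProduct.add_tmul, TensorProduct.tmul_add]
      rw [mul_comm c (growth K a), mul_comm d (growth K b), mul_comm c (degreeDerivation K a),
        mul_left_comm b, mul_assoc (tree K vertex) b d]
      abel

/-- The factor tree ⊗ 1 comes from a leaf attached to the new root, the factor 1 ⊗ tree from the new
root being counted by the degree. Together they form the coproduct of the one-vertex tree. -/
theorem growthTensor_rTensor_B (z : HCK K ⊗[K] HCK K) :
    growthTensor K ((B K).rTensor (HCK K) z) = (B K).rTensor (HCK K)
      (growthTensor K z + z * (1 ⊗ₜ tree K vertex + tree K vertex ⊗ₜ 1)) := by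
  induction z with
  | zero => simp
  | add a b ha hb =>
    rw [map_add, map_add, ha, hb, ← map_add]
    congr 1
    rw [map_add, add_mul]
    abel
  | tmul a b =>
    simp only [LinearMap.rTensor_tmul, growthTensor_tmul, mul_add, map_add, growth_B,
      degreeDerivation_B, Algebra.TensorProduct.tmul_mul_tmul, mul_one, TensorProduct.add_tmul]
    rw [mul_comm b]
    abel

theorem comulHom_vertex :
    comulHom K (tree K vertex) = 1 ⊗ₜ tree K vertex + tree K vertex ⊗ₜ 1 := by
  rw [vertex, ← B_forest, comulHom_B, forest_zero, map_one (comulHom K),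
    Algebra.TensorProduct.one_def, LinearMap.rTensor_tmul]

/-- In an admissible cut, the left factor contains the root. A new leaf is attached to a vertex of
the left part, or of the right part, or to a vertex of the left part with its own edge cut; the last
case adds a one-vertex tree on the right, once for each vertex on the left. -/
theorem comulHom_growth (x : HCK K) :
    comulHom K (growth K x) = growthTensor K (comulHom K x) := by
  have : (comulHom K).toLinearMap ∘ₗ (growth K).toLinearMap =
      growthTensor K ∘ₗ (comulHom K).toLinearMap := by
    refine eq_of_leibniz_of_B (comulHom K) (fun x y => ?_) (fun x y => ?_) fun x hx => ?_
    · simp only [LinearMap.comp_apply, Derivation.coeFn_coe, Derivation.leibniz, smul_eq_mul,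
        AlgHom.toLinearMap_apply, map_add, map_mul]
      ring
    · simp only [LinearMap.comp_apply, AlgHom.toLinearMap_apply, map_mul, growthTensor_mul]
    · simp only [LinearMap.comp_apply, AlgHom.toLinearMap_apply, Derivation.coeFn_coe] at hx ⊢
      rw [growth_B, map_add, comulHom_B, comulHom_B, comulHom_B, map_mul (comulHom K), hx,
        comulHom_vertex,
        map_add, growthTensor_rTensor_B, growthTensor_tmul, map_add, growth_B,
        Derivation.map_one_eq_zero, Derivation.map_one_eq_zero, TensorProduct.tmul_add]
      simp only [TensorProduct.zero_tmul, zero_add, add_zero]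
      abel
  exact LinearMap.congr_fun this x

variable (K) in
/-- The multiplication composed with `id ⊗ S`. -/
abbrev mulAntipode : HCK K ⊗[K] HCK K →ₐ[K] HCK K :=
  (Algebra.TensorProduct.lmul' K (S := HCK K)).comp
    (Algebra.TensorProduct.map (.id K (HCK K)) (antipodeHom K))

theorem mulAntipode_comulHom (x : HCK K) :
    mulAntipode K (comulHom K x) = algebraMap K (HCK K) (counitHom K x) :=
  AlgHom.congr_fun (mul_map_antipodeHom K) x

theorem derivation_mulAntipode_comulHom (d : Derivation K (HCK K) (HCK K)) (x : HCK K) :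
    d (mulAntipode K (comulHom K x)) = 0 := by
  rw [mulAntipode_comulHom, d.map_algebraMap]

theorem counitHom_growth (x : HCK K) : counitHom K (growth K x) = 0 := by
  have : (counitHom K).toLinearMap ∘ₗ (growth K).toLinearMap = 0 := by
    refine eq_of_leibniz (counitHom K) (fun x y => ?_) (fun x y => by simp) fun t => ?_
    · simp only [LinearMap.comp_apply, Derivation.coeFn_coe, Derivation.leibniz, smul_eq_mul,
        AlgHom.toLinearMap_apply, map_add, map_mul]
      ring
    · simp only [LinearMap.comp_apply, Derivation.coeFn_coe, graftDerivation_tree,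
        AlgHom.toLinearMap_apply, map_multiset_sum, Multiset.map_map, Function.comp_def,
        counitHom_tree]
      simp
  exact LinearMap.congr_fun this x

variable (K) in
/-- The defect of commutation of the antipode with the natural growth. -/
def antipodeDefect : HCK K →ₗ[K] HCK K :=
  (antipodeHom K).toLinearMap ∘ₗ (growth K).toLinearMap -
    (growth K).toLinearMap ∘ₗ (antipodeHom K).toLinearMap +
    LinearMap.mulLeft K (tree K vertex) ∘ₗ
      (degreeDerivation K).toLinearMap ∘ₗ (antipodeHom K).toLinearMap

theorem antipodeDefect_apply (x : HCK K) :
    antipodeDefect K x = antipodeHom K (growth K x) - growth K (antipodeHom K x) +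
      tree K vertex * degreeDerivation K (antipodeHom K x) := rfl

/-- On z = Δ x every term on the right vanishes: the first by the counit, the next two because
derivations kill scalars, the last because the antipode negates the one-vertex tree. -/
theorem mul'_map_antipodeDefect (z : HCK K ⊗[K] HCK K) :
    LinearMap.mul' K (HCK K) (TensorProduct.map LinearMap.id (antipodeDefect K) z) =
      mulAntipode K (growthTensor K z) - growth K (mulAntipode K z) +
        tree K vertex * degreeDerivation K (mulAntipode K z) -
        (antipodeHom K (tree K vertex) + tree K vertex) *
          mulAntipode K ((degreeDerivation K).toLinearMap.rTensor (HCK K) z) := by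
  induction z with
  | zero => simp
  | add a b ha hb => simp only [map_add, ha, hb]; ring
  | tmul a b =>
    simp only [growthTensor_tmul, TensorProduct.map_tmul, antipodeDefect_apply, map_add,
      AlgHom.comp_apply, Algebra.TensorProduct.map_tmul, Algebra.TensorProduct.lmul'_apply_tmul,
      LinearMap.mul'_apply, Derivation.leibniz, smul_eq_mul, map_mul, AlgHom.id_apply,
      LinearMap.id_apply, LinearMap.rTensor_tmul, Derivation.coeFn_coe]
    ring

theorem antipodeHom_vertex : antipodeHom K (tree K vertex) = -tree K vertex := by
  have h := AlgHom.congr_fun (mul_map_antipodeHom K) (tree K vertex)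
  simp only [AlgHom.comp_apply, comulHom_vertex, counitHom_tree, map_add, map_zero,
    Algebra.TensorProduct.map_tmul, Algebra.TensorProduct.lmul'_apply_tmul, map_one,
    AlgHom.id_apply, one_mul, mul_one] at h
  exact eq_neg_of_add_eq_zero_left h

open WithConv in
theorem antipodeDefect_eq_zero : antipodeDefect K = 0 := by
  have h : (toConv LinearMap.id * toConv (antipodeDefect K) :
      WithConv (HCK K →ₗ[K] HCK K)) = 0 := by
    refine WithConv.ofConv_injective (LinearMap.ext fun x => ?_)
    have h₁ : mulAntipode K (growthTensor K (comulHom K x)) = 0 := by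
      rw [← comulHom_growth, mulAntipode_comulHom, counitHom_growth, map_zero]
    refine (mul'_map_antipodeDefect (comulHom K x)).trans ?_
    rw [h₁, derivation_mulAntipode_comulHom, derivation_mulAntipode_comulHom, antipodeHom_vertex]
    simp
  have h' : (toConv (HopfAlgebra.antipode K (A := HCK K)) * toConv LinearMap.id :
      WithConv (HCK K →ₗ[K] HCK K)) = 1 := LinearMap.antipode_mul_id
  -- The identity is convolution invertible with inverse S, so it can be cancelled on the left.
  have := congrArg (fun f => toConv (HopfAlgebra.antipode K (A := HCK K)) * f) h
  simp only [← mul_assoc, h', one_mul, mul_zero] at this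
  exact congrArg ofConv this

theorem antipode_growth (x : HCK K) :
    HopfAlgebra.antipode K (growth K x) = growth K (HopfAlgebra.antipode K x) -
      tree K vertex * degreeDerivation K (HopfAlgebra.antipode K x) := by
  have h := LinearMap.congr_fun (antipodeDefect_eq_zero (K := K)) x
  rw [antipodeDefect_apply, LinearMap.zero_apply] at h
  show antipodeHom K (growth K x) = growth K (antipodeHom K x) -
    tree K vertex * degreeDerivation K (antipodeHom K x)
  linear_combination h

/-! ### Polynomials in the Connes-Moscovici generators -/

open MvPolynomial

/-- Two derivations over an algebra morphism from a polynomial algebra are equal if they agree on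
the variables. -/
theorem mvPolynomial_eq_of_leibniz {σ A : Type*} [CommRing A] [Algebra K A]
    (f : MvPolynomial σ K →ₐ[K] A) {d₁ d₂ : MvPolynomial σ K →ₗ[K] A}
    (h₁ : ∀ x y, d₁ (x * y) = d₁ x * f y + f x * d₁ y)
    (h₂ : ∀ x y, d₂ (x * y) = d₂ x * f y + f x * d₂ y)
    (h : ∀ i, d₁ (X i) = d₂ (X i)) : d₁ = d₂ := by
  refine LinearMap.ext fun p => ?_
  induction p using MvPolynomial.induction_on with
  | C a =>
    -- As on forests, the Leibniz rule at 1 * 1 makes both maps vanish on constants.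
    have e₁ := h₁ 1 1
    have e₂ := h₂ 1 1
    simp only [mul_one, one_mul, map_one, left_eq_add] at e₁ e₂
    rw [← mul_one (C a), ← smul_eq_C_mul, map_smul, map_smul, e₁, e₂]
  | add p q hp hq => rw [map_add, map_add, hp, hq]
  | mul_X p i hp => rw [h₁, h₂, hp, h]

variable (K) in
/-- The derivation that maps each variable to the next one. -/
def shift : Derivation K (MvPolynomial ℕ K) (MvPolynomial ℕ K) :=
  mkDerivation K fun j => X (j + 1)

theorem shift_X (j : ℕ) : shift K (X j) = X (j + 1) :=
  mkDerivation_X K _ j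

variable (K) in
/-- The polynomial that gives the antipode of `δ (m + 1)` in the generators, where the variable of
index `j` stands for `δ (j + 1)`. -/
def antipodePoly : ℕ → MvPolynomial ℕ K
  | 0 => -X 0
  | m + 1 => shift K (antipodePoly m) - ((m + 1 : ℕ) : K) • (X 0 * antipodePoly m)

variable (K) in
/-- The evaluation of a polynomial at the Connes-Moscovici generators. -/
def evalδ : MvPolynomial ℕ K →ₐ[K] HCK K := aeval fun j => δ K (j + 1)

theorem evalδ_X (j : ℕ) : evalδ K (X j) = δ K (j + 1) := aeval_X _ j

theorem δ_one : δ K 1 = tree K vertex := rfl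

theorem δ_add_two (m : ℕ) : δ K (m + 2) = growth K (δ K (m + 1)) := by
  rw [δ, ← forest_singleton, preLie_forest]

theorem evalδ_shift (p : MvPolynomial ℕ K) : evalδ K (shift K p) = growth K (evalδ K p) := by
  have : (evalδ K).toLinearMap ∘ₗ (shift K).toLinearMap =
      (growth K).toLinearMap ∘ₗ (evalδ K).toLinearMap := by
    refine mvPolynomial_eq_of_leibniz (evalδ K) (fun x y => ?_) (fun x y => ?_) fun j => ?_
    · simp only [LinearMap.comp_apply, Derivation.coeFn_coe, Derivation.leibniz, smul_eq_mul,
        AlgHom.toLinearMap_apply, map_add, map_mul]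
      ring
    · simp only [LinearMap.comp_apply, Derivation.coeFn_coe, Derivation.leibniz, smul_eq_mul,
        AlgHom.toLinearMap_apply, map_mul]
      ring
    · simp only [LinearMap.comp_apply, Derivation.coeFn_coe, AlgHom.toLinearMap_apply, shift_X,
        evalδ_X, δ_add_two]
  exact LinearMap.congr_fun this p

/-- The degree statement supplies the factor m + 1 in the recursion for the antipode, and propagates
along it; hence the joint induction. -/
theorem degreeDerivation_antipode_δ (m : ℕ) :
    degreeDerivation K (HopfAlgebra.antipode K (δ K (m + 1))) =
        ((m + 1 : ℕ) : K) • HopfAlgebra.antipode K (δ K (m + 1)) ∧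
      HopfAlgebra.antipode K (δ K (m + 1)) = evalδ K (antipodePoly K m) := by
  induction m with
  | zero =>
    have h : HopfAlgebra.antipode K (δ K (0 + 1)) = -tree K vertex := antipodeHom_vertex
    rw [h, antipodePoly, map_neg, map_neg, evalδ_X, degreeDerivation_tree, RTree.size_vertex]
    exact ⟨(smul_neg _ _).symm, rfl⟩
  | succ m ih =>
    have h : HopfAlgebra.antipode K (δ K (m + 1 + 1)) =
        growth K (HopfAlgebra.antipode K (δ K (m + 1))) -
          ((m + 1 : ℕ) : K) • (tree K vertex * HopfAlgebra.antipode K (δ K (m + 1))) := by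
      rw [δ_add_two, antipode_growth, ih.1, mul_smul_comm]
    constructor
    · rw [h, map_sub, Derivation.map_smul, Derivation.leibniz, degreeDerivation_growth, ih.1,
        degreeDerivation_tree, RTree.size_vertex, Derivation.map_smul]
      simp only [smul_eq_mul, Algebra.smul_def, Nat.cast_add, Nat.cast_one, map_add, map_one]
      ring
    · rw [h, ih.2, antipodePoly, map_sub, map_smul, map_mul, evalδ_X, evalδ_shift, δ_one]

theorem antipode_δ (m : ℕ) :
    HopfAlgebra.antipode K (δ K (m + 1)) = evalδ K (antipodePoly K m) :=
  (degreeDerivation_antipode_δ m).2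

/-! ### Algebraic independence of the generators -/

/-- The multiset of the trees of `δ (m + 1)`, with multiplicities. -/
def grownTrees : ℕ → Multiset RTree
  | 0 => {vertex}
  | m + 1 => (grownTrees m).bind (RTree.graftings {vertex})

theorem δ_eq_sum_grownTrees (m : ℕ) : δ K (m + 1) = ((grownTrees m).map (tree K)).sum := by
  induction m with
  | zero => simp [grownTrees, δ_one]
  | succ m ih =>
    rw [δ_add_two, ih, grownTrees, map_multiset_sum, Multiset.map_map, Multiset.map_bind,
      Multiset.sum_bind]
    congr 1
    exact Multiset.map_congr rfl fun t _ => graftDerivation_tree K _ t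

theorem size_of_mem_grownTrees (m : ℕ) : ∀ t ∈ grownTrees m, t.size = m + 1 := by
  induction m with
  | zero =>
    intro t ht
    rw [Multiset.mem_singleton.1 ht, RTree.size_vertex]
  | succ m ih =>
    intro u hu
    obtain ⟨t, ht, hu⟩ := Multiset.mem_bind.1 hu
    rw [RTree.size_of_mem_graftings _ _ _ hu, ih t ht]
    simp [RTree.size_vertex]

/-- Each tree with m + 1 vertices grows in m + 1 ways. -/
theorem card_grownTrees (m : ℕ) : (grownTrees m).card = m.factorial := by
  induction m with
  | zero => rfl
  | succ m ih =>
    rw [grownTrees, Multiset.card_bind, Multiset.map_congr (g := fun _ => m + 1) rfl fun t ht => by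
      rw [Function.comp_apply, RTree.card_graftings, size_of_mem_grownTrees m t ht]]
    simp [ih, Nat.factorial_succ, mul_comm]

theorem evalδ_injective [CharZero K] : Function.Injective (evalδ K) := by
  -- A left inverse: δ_(m+1) is a sum of m! trees, with multiplicity, all with m + 1 vertices, so
  -- dividing by m! sends it to X_m.
  let φ : HCK K →ₐ[K] MvPolynomial ℕ K :=
    liftTree fun t => ((t.size - 1).factorial : K)⁻¹ • X (t.size - 1)
  have h : φ.comp (evalδ K) = AlgHom.id K _ := by
    refine MvPolynomial.algHom_ext fun m => ?_
    rw [AlgHom.comp_apply, evalδ_X, δ_eq_sum_grownTrees, map_multiset_sum, Multiset.map_map,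
      Multiset.map_congr (g := fun _ => (m.factorial : K)⁻¹ • X m) rfl fun t ht => by
        rw [Function.comp_apply, liftTree_tree, size_of_mem_grownTrees m t ht,
          Nat.add_sub_cancel]]
    rw [Multiset.map_const', Multiset.sum_replicate, card_grownTrees, ← Nat.cast_smul_eq_nsmul K,
      smul_smul, mul_inv_cancel₀ (Nat.cast_ne_zero.2 m.factorial_ne_zero), one_smul]
    rfl
  exact Function.LeftInverse.injective (g := φ) fun p => AlgHom.congr_fun h p

/-! ### Homogeneity -/

theorem isWeightedHomogeneous_shift {p : MvPolynomial ℕ K} {n : ℕ}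
    (hp : IsWeightedHomogeneous (fun j : ℕ => j + 1) p n) :
    IsWeightedHomogeneous (fun j : ℕ => j + 1) (shift K p) (n + 1) := by
  rw [p.as_sum, map_sum]
  refine IsWeightedHomogeneous.sum _ _ _ fun d hd => ?_
  have hd' := hp (mem_support_iff.1 hd)
  rw [shift, mkDerivation_monomial]
  refine (mem_weightedHomogeneousSubmodule _ _ _ _).1 (Submodule.smul_mem _ _ ?_)
  refine Submodule.sum_mem _ fun i hi => ?_
  rw [mem_weightedHomogeneousSubmodule]
  have hi' : Finsupp.single i 1 ≤ d :=
    Finsupp.single_le_iff.2 (Nat.one_le_iff_ne_zero.2 (Finsupp.mem_support_iff.1 hi))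
  -- Replacing one factor X_i, of weight i + 1, by X_(i+1) raises the weight by one.
  have h := congrArg (Finsupp.weight fun j : ℕ => j + 1) (tsub_add_cancel_of_le hi')
  rw [map_add, hd', Finsupp.weight_single, one_smul] at h
  have := (isWeightedHomogeneous_monomial (fun j : ℕ => j + 1) (d - Finsupp.single i 1) (d i : K)
    rfl).mul (isWeightedHomogeneous_X K (fun j : ℕ => j + 1) (i + 1))
  rw [← h]
  exact this

theorem isWeightedHomogeneous_antipodePoly (m : ℕ) :
    IsWeightedHomogeneous (fun j : ℕ => j + 1) (antipodePoly K m) (m + 1) := by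
  induction m with
  | zero => exact (isWeightedHomogeneous_X K (fun j : ℕ => j + 1) 0).neg
  | succ m ih =>
    refine (isWeightedHomogeneous_shift ih).sub ((mem_weightedHomogeneousSubmodule _ _ _ _).1
      (Submodule.smul_mem _ _ ?_))
    rw [add_comm]
    exact (isWeightedHomogeneous_X K (fun j : ℕ => j + 1) 0).mul ih

/-! ### The coefficients of hook type -/

variable (K) in
/-- The evaluation of the first variable at `1`, and of the others at `0`. -/
def evalFirst : MvPolynomial ℕ K →ₐ[K] K := aeval (Pi.single 0 1)

theorem evalFirst_X_zero : evalFirst K (X 0) = 1 := by simp [evalFirst]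

theorem evalFirst_X_succ (j : ℕ) : evalFirst K (X (j + 1)) = 0 := by simp [evalFirst]

/-- Each term of a shifted polynomial contains a variable of positive index, which is evaluated at
0. -/
theorem evalFirst_shift (p : MvPolynomial ℕ K) : evalFirst K (shift K p) = 0 := by
  have : (evalFirst K).toLinearMap ∘ₗ (shift K).toLinearMap = 0 := by
    refine mvPolynomial_eq_of_leibniz (evalFirst K) (fun x y => ?_) (fun x y => by simp) fun j => ?_
    · simp only [LinearMap.comp_apply, Derivation.coeFn_coe, Derivation.leibniz, smul_eq_mul,
        AlgHom.toLinearMap_apply, map_add, map_mul]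
      ring
    · simp [shift_X, evalFirst_X_succ]
  exact LinearMap.congr_fun this p

theorem pderiv_zero_shift (p : MvPolynomial ℕ K) :
    pderiv 0 (shift K p) = shift K (pderiv 0 p) := by
  have : ⁅pderiv 0, shift K⁆ = 0 := derivation_ext fun j => by
    rw [Derivation.commutator_apply, shift_X, pderiv_X, pderiv_X]
    rcases eq_or_ne j 0 with rfl | hj
    · simp
    · simp [hj]
  have h := Derivation.congr_fun this p
  rw [Derivation.commutator_apply] at h
  exact sub_eq_zero.1 h

/-- As shift is the sum of the X_(j+1) ∂_j, differentiating the factor X_(i+1) leaves ∂_i. -/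
theorem pderiv_succ_shift (i : ℕ) (p : MvPolynomial ℕ K) :
    pderiv (i + 1) (shift K p) = shift K (pderiv (i + 1) p) + pderiv i p := by
  have : ⁅pderiv (i + 1), shift K⁆ = pderiv i := derivation_ext fun j => by
    rw [Derivation.commutator_apply, shift_X, pderiv_X, pderiv_X, pderiv_X]
    simp only [Pi.single_apply, Nat.add_right_cancel_iff]
    split_ifs <;> simp
  have h := Derivation.congr_fun this p
  rw [Derivation.commutator_apply] at h
  exact sub_eq_iff_eq_add'.1 h

variable (K) in
/-- The sum of the coefficients of the monomials `X 0 ^ a * X j`, for `j ≥ 1`. -/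
def hookSum (j : ℕ) : MvPolynomial ℕ K →ₗ[K] K :=
  (evalFirst K).toLinearMap ∘ₗ (pderiv j).toLinearMap

theorem hookSum_apply (j : ℕ) (p : MvPolynomial ℕ K) :
    hookSum K j p = evalFirst K (pderiv j p) := rfl

theorem evalFirst_antipodePoly (m : ℕ) :
    evalFirst K (antipodePoly K m) = (-1) ^ (m + 1) * (m.factorial : K) := by
  induction m with
  | zero => simp [antipodePoly, evalFirst_X_zero]
  | succ m ih =>
    rw [antipodePoly, map_sub, map_smul, map_mul, evalFirst_shift, evalFirst_X_zero, ih,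
      Nat.factorial_succ]
    push_cast
    rw [smul_eq_mul]
    ring

/-- Boundary value of the recursion on j. For j = 0, differentiation multiplies the coefficient of
X_0^(m+1) by m + 1, whence (m + 1)! instead of m!. -/
theorem hookSum_zero_antipodePoly (m : ℕ) :
    hookSum K 0 (antipodePoly K m) = (-1) ^ (m + 1) * ((m + 1).factorial : K) := by
  induction m with
  | zero => simp [antipodePoly, hookSum_apply]
  | succ m ih =>
    rw [hookSum_apply] at ih ⊢
    rw [antipodePoly, map_sub, Derivation.map_smul, Derivation.leibniz, pderiv_zero_shift, map_sub,
      map_smul, map_add, evalFirst_shift, pderiv_X_self, smul_eq_mul, smul_eq_mul, smul_eq_mul,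
      map_mul,
      map_mul, ih, evalFirst_antipodePoly, evalFirst_X_zero, map_one, Nat.factorial_succ (m + 1),
      Nat.factorial_succ m]
    push_cast
    ring

theorem hookSum_succ_antipodePoly_succ (j m : ℕ) :
    hookSum K (j + 1) (antipodePoly K (m + 1)) =
      hookSum K j (antipodePoly K m) - (m + 1) * hookSum K (j + 1) (antipodePoly K m) := by
  simp only [hookSum_apply]
  rw [antipodePoly, map_sub, Derivation.map_smul, Derivation.leibniz, pderiv_succ_shift, map_sub,
    map_smul, map_add, map_add, evalFirst_shift, pderiv_X_of_ne (Nat.succ_ne_zero j).symm,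
    smul_eq_mul, smul_eq_mul, smul_zero, map_mul, evalFirst_X_zero]
  simp

/-! ### Iterated harmonic sums and the solution of the recursion -/

theorem iteratedHarmonic_zero (n : ℕ) : iteratedHarmonic K 0 n = 1 := by
  simp [iteratedHarmonic]

theorem iteratedHarmonic_succ_zero (i : ℕ) : iteratedHarmonic K (i + 1) 0 = 0 := by
  rw [iteratedHarmonic, Finset.powersetCard_eq_empty.2 (by simp), Finset.sum_empty]

theorem iteratedHarmonic_succ_succ (i n : ℕ) :
    iteratedHarmonic K (i + 1) (n + 1) =
      iteratedHarmonic K (i + 1) n + iteratedHarmonic K i n / (n + 1) := by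
  have hn : n + 1 ∉ Finset.Icc 1 n := by simp
  -- Split the subsets according to whether they contain n + 1.
  rw [iteratedHarmonic, ← Finset.insert_Icc_right_eq_Icc_add_one (by omega),
    Finset.powersetCard_succ_insert hn, Finset.sum_union, Finset.sum_image]
  · congr 1
    rw [iteratedHarmonic, Finset.sum_div]
    refine Finset.sum_congr rfl fun s hs => ?_
    rw [Finset.prod_insert fun h => hn ((Finset.mem_powersetCard.1 hs).1 h), mul_comm,
      div_mul_eq_div_div]
    push_cast
    rfl
  · intro s hs t ht h
    rw [← Finset.erase_insert (fun h => hn ((Finset.mem_powersetCard.1 hs).1 h)),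
      ← Finset.erase_insert (fun h => hn ((Finset.mem_powersetCard.1 ht).1 h)), h]
  · rw [Finset.disjoint_right]
    intro s hs hs'
    obtain ⟨t, _, rfl⟩ := Finset.mem_image.1 hs
    exact hn ((Finset.mem_powersetCard.1 hs').1 (Finset.mem_insert_self _ _))

theorem hookSum_antipodePoly [CharZero K] (m j : ℕ) :
    hookSum K (j + 1) (antipodePoly K m) = (-1) ^ (m + j) * (m.factorial : K) *
      (m - ∑ i ∈ Finset.range j, iteratedHarmonic K (i + 1) m) := by
  induction m generalizing j with
  | zero => simp [antipodePoly, hookSum_apply, iteratedHarmonic_succ_zero]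
  | succ m ih =>
    have hm : (m : K) + 1 ≠ 0 := by exact_mod_cast m.succ_ne_zero
    rw [hookSum_succ_antipodePoly_succ, ih]
    rcases j with _ | j
    · rw [hookSum_zero_antipodePoly, Nat.factorial_succ]
      push_cast
      simp only [Finset.range_zero, Finset.sum_empty]
      ring
    · simp only [iteratedHarmonic_succ_succ, Finset.sum_add_distrib, ← Finset.sum_div]
      -- The sum starting at H^(0) = 1 contributes 1 / (m + 1), which completes m / (m + 1) to 1.
      rw [ih, Finset.sum_range_succ' (fun i => iteratedHarmonic K i m), iteratedHarmonic_zero,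
        Nat.factorial_succ]
      push_cast
      field_simp
      ring

/-! ### Reading coefficients off monomials -/

open Classical in
theorem evalFirst_monomial (d : ℕ →₀ ℕ) (a : K) :
    evalFirst K (monomial d a) = if ∀ l, d (l + 1) = 0 then a else 0 := by
  rw [evalFirst, aeval_monomial, Finsupp.prod]
  split_ifs with h
  · rw [Finset.prod_eq_one fun l hl => ?_]
    · simp
    · rcases l with _ | l
      · simp
      · exact absurd (h l) (Finsupp.mem_support_iff.1 hl)
  · push Not at h
    obtain ⟨l, hl⟩ := h
    rw [Finset.prod_eq_zero (Finsupp.mem_support_iff.2 hl) (by simp [hl]), mul_zero]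

open Classical in
theorem hookSum_monomial (j : ℕ) (d : ℕ →₀ ℕ) :
    hookSum K (j + 1) (monomial d 1) =
      if ∀ l, d (l + 1) = if l = j then 1 else 0 then 1 else 0 := by
  rw [hookSum_apply, pderiv_monomial, evalFirst_monomial, one_mul]
  simp only [Finsupp.tsub_apply, Finsupp.single_apply, Nat.add_right_cancel_iff]
  -- When the variable is absent, the truncated exponent is meaningless, but the derivative has
  -- coefficient 0.
  by_cases hd : d (j + 1) = 0
  · rw [hd, Nat.cast_zero, ite_self, if_neg fun h => by simpa [hd] using h j]
  · have : (∀ l, (d (l + 1) - if j = l then 1 else 0) = 0) ↔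
        ∀ l, d (l + 1) = if l = j then 1 else 0 := by
      refine forall_congr' fun l => ?_
      by_cases hl : l = j
      · subst hl
        simp only [if_true]
        omega
      · simp [hl, Ne.symm hl]
    simp only [this]
    split_ifs with h
    · rw [h j, if_pos rfl, Nat.cast_one]
    · rfl

/-- The exponent of the monomial attached to a sequence `(i_1, …, i_n)`. -/
def exponent {n : ℕ} (i : Fin n → ℕ) : ℕ →₀ ℕ :=
  (Finsupp.equivFunOnFinite.symm i).embDomain Fin.valEmbedding

theorem exponent_val {n : ℕ} (i : Fin n → ℕ) (j : Fin n) : exponent i (j : ℕ) = i j :=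
  Finsupp.embDomain_apply_self Fin.valEmbedding _ j

theorem exponent_of_le {n : ℕ} (i : Fin n → ℕ) {l : ℕ} (hl : n ≤ l) : exponent i l = 0 :=
  Finsupp.embDomain_of_notMem_range _ _ _ (by rintro ⟨j, rfl⟩; exact absurd j.2 (not_lt.2 hl))

theorem exponent_injective {n : ℕ} :
    Function.Injective (exponent : (Fin n → ℕ) → ℕ →₀ ℕ) := by
  intro i i' h
  funext j
  rw [← exponent_val i, h, exponent_val]

theorem monomial_exponent {n : ℕ} (i : Fin n → ℕ) :
    (monomial (exponent i) (1 : K)) = ∏ j : Fin n, X (j : ℕ) ^ i j := by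
  rw [monomial_eq, C_1, one_mul, exponent, Finsupp.prod_embDomain,
    Finsupp.prod_fintype _ _ (by simp)]
  rfl

theorem weight_exponent {n : ℕ} (i : Fin n → ℕ) :
    Finsupp.weight (fun j : ℕ => j + 1) (exponent i) = ∑ j : Fin n, ((j : ℕ) + 1) * i j := by
  rw [Finsupp.weight_apply, exponent, Finsupp.sum_embDomain, Finsupp.sum_fintype _ _ (by simp)]
  exact Finset.sum_congr rfl fun j _ => mul_comm _ _

theorem exists_exponent_eq {n : ℕ} {d : ℕ →₀ ℕ}
    (hd : Finsupp.weight (fun j : ℕ => j + 1) d = n) : ∃ i : indices n, exponent i.1 = d := by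
  have h : exponent (fun j : Fin n => d j) = d := by
    ext l
    rcases lt_or_ge l n with hl | hl
    · exact exponent_val _ ⟨l, hl⟩
    · rw [exponent_of_le _ hl]
      by_contra h
      -- A variable X_l that occurs contributes at least l + 1 to the weight n, so l < n.
      have := Finsupp.le_weight_of_ne_zero' (fun j : ℕ => j + 1) (Ne.symm h)
      omega
  refine ⟨⟨fun j => d j, ?_⟩, h⟩
  rw [mem_indices, ← weight_exponent, h, hd]

theorem isAntipodeCoeff_iff [CharZero K] (m : ℕ) (a : indices (m + 1) → K) :
    IsAntipodeCoeff K (m + 1) a ↔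
      antipodePoly K m = ∑ i, a i • monomial (exponent i.1) (1 : K) := by
  rw [IsAntipodeCoeff, antipode_δ, ← evalδ_injective.eq_iff, map_sum]
  simp only [map_smul, monomial_exponent, map_prod, map_pow, evalδ_X]

theorem coeff_sum_monomial_exponent {n : ℕ} (a : indices n → K) (i : indices n) :
    coeff (exponent i.1) (∑ i, a i • monomial (exponent i.1) (1 : K)) = a i := by
  rw [coeff_sum, Finset.sum_eq_single i]
  · rw [coeff_smul, coeff_monomial, if_pos rfl, smul_eq_mul, mul_one]
  · intro i' _ hi
    rw [coeff_smul, coeff_monomial, if_neg fun h => hi (Subtype.ext (exponent_injective h)),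
      smul_zero]
  · exact fun h => absurd (Finset.mem_univ i) h

theorem existsUnique_isAntipodeCoeff [CharZero K] (m : ℕ) :
    ∃! a : indices (m + 1) → K, IsAntipodeCoeff K (m + 1) a := by
  -- By homogeneity, only exponents coming from `indices` can occur in the polynomial.
  refine ⟨fun i => coeff (exponent i.1) (antipodePoly K m), ?_, fun a ha => ?_⟩
  · refine (isAntipodeCoeff_iff m _).2 ?_
    ext d
    by_cases hd : Finsupp.weight (fun j : ℕ => j + 1) d = m + 1
    · obtain ⟨i, rfl⟩ := exists_exponent_eq hd
      rw [coeff_sum_monomial_exponent]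
    · rw [(isWeightedHomogeneous_antipodePoly m).coeff_eq_zero d hd, coeff_sum]
      refine (Finset.sum_eq_zero fun i _ => ?_).symm
      have : exponent i.1 ≠ d := by
        rintro rfl
        exact hd ((weight_exponent _).trans ((mem_indices _).1 i.2))
      rw [coeff_smul, coeff_monomial, if_neg this, smul_zero]
  · funext i
    rw [(isAntipodeCoeff_iff m a).1 ha, coeff_sum_monomial_exponent]

/-- The weight equation determines the first entry from the others. Hence `hookSum` isolates a
single coefficient. -/
theorem exponent_eq_hook_iff {m k : ℕ} (hk : 2 ≤ k) (hkm : k ≤ m + 1) (i : indices (m + 1)) :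
    (∀ l, exponent i.1 (l + 1) = if l = k - 2 then 1 else 0) ↔
      i = hookIndex (m + 1) k hk hkm := by
  have hook : ∀ l : Fin m, (hookIndex (m + 1) k hk hkm).1 l.succ =
      if (l : ℕ) = k - 2 then 1 else 0 := by
    intro l
    simp only [hookIndex, Fin.val_succ]
    split_ifs <;> omega
  constructor
  · intro h
    have hs : ∀ l : Fin m, i.1 l.succ = (hookIndex (m + 1) k hk hkm).1 l.succ := by
      intro l
      rw [hook, ← exponent_val i.1, Fin.val_succ, h]
    have h₁ := (mem_indices _).1 i.2
    have h₂ := (mem_indices _).1 (hookIndex (m + 1) k hk hkm).2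
    rw [Fin.sum_univ_succ] at h₁ h₂
    simp only [hs] at h₁
    have h₀ := add_right_cancel (h₁.trans h₂.symm)
    refine Subtype.ext (funext fun j => ?_)
    refine Fin.cases ?_ hs j
    simpa using h₀
  · rintro rfl l
    rcases lt_or_ge l m with hl | hl
    · rw [← hook ⟨l, hl⟩, ← exponent_val (hookIndex (m + 1) k hk hkm).1, Fin.val_succ]
    · rw [exponent_of_le _ (by omega), if_neg (by omega)]

theorem coeff_hookIndex [CharZero K] {m k : ℕ} (hk : 2 ≤ k) (hkm : k ≤ m + 1)
    {a : indices (m + 1) → K} (ha : IsAntipodeCoeff K (m + 1) a) :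
    a (hookIndex (m + 1) k hk hkm) = hookSum K (k - 2 + 1) (antipodePoly K m) := by
  classical
  rw [(isAntipodeCoeff_iff m a).1 ha, map_sum]
  simp only [map_smul, hookSum_monomial, exponent_eq_hook_iff hk hkm, smul_eq_mul, mul_ite,
    mul_one, mul_zero]
  simp

theorem sum_hookIndex {m k : ℕ} (hk : 2 ≤ k) (hkm : k ≤ m + 1) :
    ∑ j, (hookIndex (m + 1) k hk hkm).1 j = m + 1 - k + 1 := by
  rw [Fin.sum_univ_succ, Finset.sum_eq_single (⟨k - 2, by omega⟩ : Fin m)]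
  · simp only [hookIndex, Fin.val_succ, Fin.val_zero]
    split_ifs <;> omega
  · intro j _ hj
    have : (j : ℕ) ≠ k - 2 := fun h => hj (Fin.ext h)
    simp only [hookIndex, Fin.val_succ]
    split_ifs <;> omega
  · simp

end ConnesKreimer

end

theorem mainTheorem5 (K : Type*) [Field K] [CharZero K] (n k : ℕ) (hk : 2 ≤ k) (hkn : k ≤ n) :
    (∃! a : ConnesKreimer.indices n → K, ConnesKreimer.IsAntipodeCoeff K n a) ∧
    ∀ a : ConnesKreimer.indices n → K, ConnesKreimer.IsAntipodeCoeff K n a →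
      ConnesKreimer.normalizedCoeff a (ConnesKreimer.hookIndex n k hk hkn) =
        (n : K) - 1 - ∑ i ∈ Finset.Icc 1 (k - 2), ConnesKreimer.iteratedHarmonic K i (n - 1) := by
  obtain ⟨m, rfl⟩ : ∃ m, n = m + 1 := ⟨n - 1, by omega⟩
  refine ⟨ConnesKreimer.existsUnique_isAntipodeCoeff m, fun a ha => ?_⟩
  rw [ConnesKreimer.normalizedCoeff, ConnesKreimer.sum_hookIndex,
    ConnesKreimer.coeff_hookIndex hk hkn ha,
    ConnesKreimer.hookSum_antipodePoly, Nat.add_sub_cancel, ← Finset.Ico_add_one_right_eq_Icc,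
    Finset.sum_Ico_eq_sum_range, Nat.add_sub_cancel]
  have hm : (m.factorial : K) ≠ 0 := Nat.cast_ne_zero.2 m.factorial_ne_zero
  -- The hook monomial has n - k + 1 factors; with m = n - 1 the two sign exponents add up to 2m.
  have hs : (-1 : K) ^ (m + 1 - k + 1) * (-1) ^ (m + (k - 2)) = 1 := by
    rw [← pow_add]
    exact Even.neg_one_pow ⟨m, by omega⟩
  simp only [add_comm 1]
  push_cast
  rw [add_sub_cancel_right, div_mul_eq_mul_div, ← mul_assoc, ← mul_assoc, hs, one_mul,
    mul_div_cancel_left₀ _ hm]
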